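/- All Hilbert spaces are finite-dimensional. Let $\mathcal N_{A\to B}$ be a quantum channel (a completely positive trace-preserving linear map) with $A\neq 0$, and let $M\ge 1$ be an integer. For $\varepsilon\in[0,1]$, an $(M,\varepsilon)$ entanglement-assisted classical code consists of finite-dimensional systems $R',A'$, a shared density operator $\Psi_{R'A'}$, encoding channels $\mathcal E^m_{A'\to A}$ $(1\le m\le M)$ and a decoding POVM $\{\Lambda^m_{R'B}\}_{m=1}^M$ such that $$\frac1M\sum_{m=1}^M\operatorname{Tr}\{(I-\Lambda^m_{R'B})\,\mathcal N_{A\to B}(\mathcal E^m_{A'\to A}(\Psi_{R'A'}))\}\le\varepsilon .$$ Let $\varepsilon^*(\mathcal N,M)$ be the infimum of all $\varepsilon\in[0,1]$ for which an $(M,\varepsilon)$ code exists. For a density operator $\rho$, a positive semi-definite operator $\sigma$ and $s\in[0,1)$ let $D_s(\rho\Vert\sigma)=\frac1{s-1}\log_2\operatorname{Tr}\{\rho^s\sigma^{1-s}\}$, where powers are taken on the support (so $\rho^0$ is the support projection), and let $D_1$ be the quantum relative entropy $D(\rho\Vert\sigma)=\operatorname{Tr}\{\rho[\log_2\rho-\log_2\sigma]\}$,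 which is $+\infty$ unless $\operatorname{supp}\rho\subseteq\operatorname{supp}\sigma$. For a bipartite state $\omega_{RB}$ let $I_s(R;B)_\omega=D_s(\omega_{RB}\Vert\omega_R\otimes\omega_B)$ (the Petz–Rényi mutual information). **Theorem.** With $\log_2 0=-\infty$, $$-\log_2\varepsilon^*(\mathcal N,M)\;\ge\;\sup_{s\in[0,1]}(1-s)\Big[\sup_{\theta_{RA}}I_s(R;B)_{\mathcal N(\theta)}-\log_2M\Big]-2,$$ where the inner supremum is over all finite-dimensional systems $R$ and all pure bipartite states $\theta_{RA}$, and $\mathcal N(\theta)$ denotes $(\mathrm{id}_R\otimes\mathcal N_{A\to B})(\theta_{RA})$. -/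

import Mathlib

open scoped Matrix Kronecker ComplexOrder

universe u

noncomputable section

namespace QInfo

/- A finite-dimensional Hilbert space is `ℂ^A` for a finite index type `A`, operators on it are
matrices `Matrix A A ℂ`, and the composite system of `A` and `B` has index type `A × B`. -/

/-- Density operators: positive semi-definite with unit trace. -/
def IsState {A : Type u} [Fintype A] (ρ : Matrix A A ℂ) : Prop :=
  ρ.PosSemidef ∧ ρ.trace = 1

/-- Pure states: `ρ = |ψ⟩⟨ψ|` for a unit vector `ψ`. -/
def IsPureState {A : Type u} [Fintype A] (ρ : Matrix A A ℂ) : Prop :=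
  ∃ ψ : A → ℂ, ∑ i, ‖ψ i‖ ^ 2 = 1 ∧ ρ = Matrix.vecMulVec ψ (star ψ)

/-- The marginal on the left system (partial trace over the right one). -/
def marginalLeft {R B : Type u} [Fintype B] (ρ : Matrix (R × B) (R × B) ℂ) : Matrix R R ℂ :=
  Matrix.of fun r r' => ∑ b, ρ (r, b) (r', b)

/-- The marginal on the right system (partial trace over the left one). -/
def marginalRight {R B : Type u} [Fintype R] (ρ : Matrix (R × B) (R × B) ℂ) : Matrix B B ℂ :=
  Matrix.of fun b b' => ∑ r, ρ (r, b) (r, b')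

/-- The map `id_R ⊗ Φ` on operators of the composite system `R × A`. -/
def idTensor {R A B : Type*} (Φ : Matrix A A ℂ →ₗ[ℂ] Matrix B B ℂ)
    (X : Matrix (R × A) (R × A) ℂ) : Matrix (R × B) (R × B) ℂ :=
  Matrix.of fun x y => Φ (Matrix.of fun a a' => X (x.1, a) (y.1, a')) x.2 y.2

/-- Quantum channels: completely positive trace-preserving linear maps. -/
structure Channel (A B : Type u) [Fintype A] [Fintype B] where
  toMap : Matrix A A ℂ →ₗ[ℂ] Matrix B B ℂ
  completelyPositive : ∀ (k : ℕ) (X : Matrix (Fin k × A) (Fin k × A) ℂ),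
    X.PosSemidef → (idTensor toMap X).PosSemidef
  tracePreserving : ∀ X : Matrix A A ℂ, (toMap X).trace = X.trace

/-- The action of a channel on the right half of a bipartite operator. -/
def Channel.onRight {R A B : Type u} [Fintype A] [Fintype B] (N : Channel A B)
    (X : Matrix (R × A) (R × A) ℂ) : Matrix (R × B) (R × B) ℂ :=
  idTensor N.toMap X

/-- Binary logarithm of a non-negative real number with values in `[-∞, +∞]`; `log₂ 0 = -∞`. -/
def log2 (x : ℝ) : EReal :=
  if 0 < x then ((Real.logb 2 x : ℝ) : EReal) else ⊥

/-- The power `ρ^α` of a positive semi-definite operator, taken on its support: each eigenvalue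
`t ≠ 0` becomes `t ^ α` and the kernel is kept, so that `ρ^0` is the support projection. -/
def suppPow {A : Type u} [Fintype A] [DecidableEq A] (ρ : Matrix A A ℂ) (α : ℝ) : Matrix A A ℂ :=
  cfc (fun t : ℝ => if t = 0 then 0 else t ^ α) ρ

/-- The binary logarithm of a positive semi-definite operator, taken on its support. -/
def suppLog {A : Type u} [Fintype A] [DecidableEq A] (ρ : Matrix A A ℂ) : Matrix A A ℂ :=
  cfc (fun t : ℝ => Real.logb 2 t) ρ

/-- `supp ρ ⊆ supp σ` for positive semi-definite operators, that is, `ker σ ⊆ ker ρ`. -/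
def SuppLE {A : Type u} [Fintype A] (ρ σ : Matrix A A ℂ) : Prop :=
  ∀ v : A → ℂ, σ *ᵥ v = 0 → ρ *ᵥ v = 0

open Classical in
/-- The quantum relative entropy `D(ρ‖σ)`. -/
def relEntropy {A : Type u} [Fintype A] [DecidableEq A] (ρ σ : Matrix A A ℂ) : EReal :=
  if SuppLE ρ σ then (((ρ * (suppLog ρ - suppLog σ)).trace.re : ℝ) : EReal) else ⊤

open Classical in
/-- The (Petz) quantum Rényi relative entropy `D_α(ρ‖σ)` of order `α ≥ 0`, where the order `1`
stands for the quantum relative entropy. -/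
def renyiDiv {A : Type u} [Fintype A] [DecidableEq A] (α : ℝ) (ρ σ : Matrix A A ℂ) : EReal :=
  if α = 1 then relEntropy ρ σ
  else if 1 < α ∧ ¬ SuppLE ρ σ then ⊤
  else ((1 / (α - 1) : ℝ) : EReal) * log2 (suppPow ρ α * suppPow σ (1 - α)).trace.re

/-- The Rényi mutual information `I_α(R;B)_ρ = D_α(ρ_RB‖ρ_R ⊗ ρ_B)`. -/
def renyiMutualInfo {R B : Type u} [Fintype R] [DecidableEq R] [Fintype B] [DecidableEq B]
    (α : ℝ) (ρ : Matrix (R × B) (R × B) ℂ) : EReal :=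
  renyiDiv α ρ (marginalLeft ρ ⊗ₖ marginalRight ρ)

/-- An entanglement-assisted classical code with `M` messages for the channel `N` from `A'` to `B`,
using the shared systems `R` (receiver) and `A` (sender): a shared state, an encoding channel for
each message, and a decoding measurement (POVM). -/
structure EACode {A' B : Type u} [Fintype A'] [Fintype B] (N : Channel A' B) (M : ℕ)
    (R A : Type u) [Fintype R] [DecidableEq R] [Fintype A] [DecidableEq B] where
  shared : Matrix (R × A) (R × A) ℂ
  shared_isState : IsState shared
  enc : Fin M → Channel A A'
  povm : Fin M → Matrix (R × B) (R × B) ℂ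
  povm_posSemidef : ∀ m, (povm m).PosSemidef
  povm_sum : ∑ m, povm m = 1

/-- The average error probability of a code. -/
def EACode.avgError {A' B : Type u} [Fintype A'] [Fintype B] {N : Channel A' B} {M : ℕ}
    {R A : Type u} [Fintype R] [DecidableEq R] [Fintype A] [DecidableEq B]
    (C : EACode N M R A) : ℝ :=
  (1 / (M : ℝ)) *
    ∑ m, ((1 - C.povm m) * N.onRight ((C.enc m).onRight C.shared)).trace.re

/-- There is an `(M, ε)` entanglement-assisted classical code for `N`. -/
def HasEACode {A' B : Type u} [Fintype A'] [Fintype B] [DecidableEq B] (N : Channel A' B)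
    (M : ℕ) (ε : ℝ) : Prop :=
  ∃ (R A : Type u) (_ : Fintype R) (_ : DecidableEq R) (_ : Fintype A) (C : EACode N M R A),
    C.avgError ≤ ε

/-- `ε*(N, M)`: the infimum of all `ε ∈ [0,1]` for which there is an `(M, ε)` code. -/
def optError {A' B : Type u} [Fintype A'] [Fintype B] [DecidableEq B] (N : Channel A' B)
    (M : ℕ) : ℝ :=
  sInf {ε : ℝ | ε ∈ Set.Icc (0 : ℝ) 1 ∧ HasEACode N M ε}

/-- The supremum of `I_s(R;B)_{N(θ)}` over all finite-dimensional systems `R` and all pure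
bipartite states `θ_RA`. -/
def supRenyiMutualInfo {A B : Type u} [Fintype A] [Fintype B] [DecidableEq B]
    (N : Channel A B) (s : ℝ) : EReal :=
  ⨆ (R : Type u) (_ : Fintype R) (_ : DecidableEq R) (θ : Matrix (R × A) (R × A) ℂ)
    (_ : IsPureState θ), renyiMutualInfo s (N.onRight θ)

end QInfo

end

/-! Position-based coding. The parties share `M` copies of a pure state `θ`, and message `m` is sent
by feeding the sender's half of copy `m` into the channel. The receiver's systems at position `m`
together with `B` are then in `ρ = N(θ)`, while any other position together with `B` is in the
product `σ` of the marginals of `ρ`. Decoding thus reduces to testing `ρ` against `σ`.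

Given a test `T`, the square-root measurement built from its copies at the `M` positions has error
at most `2 Tr (1-T)ρ + 4(M-1) Tr Tσ` by `hayashi_nagaoka`. This is at most four times the error sum
of `T` for the pair `ρ`, `Mσ`, which `exists_test_le` bounds by `M^(1-s) Tr ρ^s σ^(1-s)`. Taking
logarithms gives the claim, and the final `2` is the logarithm of the factor 4. -/

namespace QInfo

open scoped MatrixOrder

/-! ### Algebra of powers taken on the support. -/

section FunctionalCalculus

variable {n : Type u} [Fintype n] [DecidableEq n]

lemma continuousOn_spectrum (A : Matrix n n ℂ) (f : ℝ → ℝ) : ContinuousOn f (spectrum ℝ A) :=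
  A.finite_real_spectrum.continuousOn f

lemma suppPow_posSemidef (A : Matrix n n ℂ) (hA : A.PosSemidef) (s : ℝ) :
    (suppPow A s).PosSemidef := by
  rw [← Matrix.nonneg_iff_posSemidef, suppPow]
  refine cfc_nonneg fun t ht => ?_
  have := spectrum_nonneg_of_nonneg hA.nonneg ht
  split_ifs <;> positivity

lemma suppPow_mul_suppPow (A : Matrix n n ℂ) (hA : A.PosSemidef) {s t r : ℝ} (h : s + t = r) :
    suppPow A s * suppPow A t = suppPow A r := by
  rw [suppPow, suppPow, suppPow, ← cfc_mul _ _ A (continuousOn_spectrum _ _) (continuousOn_spectrum _ _)]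
  refine cfc_congr fun x hx => ?_
  have := spectrum_nonneg_of_nonneg hA.nonneg hx
  rcases eq_or_ne x 0 with rfl | h0
  · simp
  · simp only [h0, if_false]
    rw [← Real.rpow_add (lt_of_le_of_ne this h0.symm), h]

lemma suppPow_one (A : Matrix n n ℂ) (hA : A.PosSemidef) :
    suppPow A 1 = A := by
  have : (fun x : ℝ => if x = 0 then 0 else x ^ (1 : ℝ)) = fun x => x := by
    ext x; simp +contextual [eq_comm]
  rw [suppPow, this, cfc_id' ℝ A hA.isHermitian.isSelfAdjoint]

lemma suppPow_smul (A : Matrix n n ℂ) (hA : A.PosSemidef) {c : ℝ} (hc : 0 < c) (s : ℝ) :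
    suppPow (c • A) s = c ^ s • suppPow A s := by
  rw [suppPow, suppPow, ← cfc_smul _ _ A (continuousOn_spectrum _ _), ← cfc_comp_smul c _ A (by
    exact (A.finite_real_spectrum.image _).continuousOn _) hA.isHermitian.isSelfAdjoint]
  refine cfc_congr fun x hx => ?_
  have := spectrum_nonneg_of_nonneg hA.nonneg hx
  rcases eq_or_ne x 0 with rfl | h0
  · simp
  · simp [h0, hc.ne', Real.mul_rpow hc.le this]

end FunctionalCalculus

section Monotone

open scoped Matrix.Norms.L2Operator

variable {n : Type u} [Fintype n] [DecidableEq n]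

/-- The Löwner–Heinz inequality. For `s ≠ 0` the support convention agrees with `x ^ s` at `x = 0`;
at `s = 0` it does not, since `0 ^ 0 = 1`. -/
lemma suppPow_mono {A B : Matrix n n ℂ} (hA : A.PosSemidef) (hAB : A ≤ B) {s : ℝ}
    (hs : 0 < s) (hs1 : s ≤ 1) :
    suppPow A s ≤ suppPow B s := by
  have h := CFC.rpow_le_rpow (p := s) ⟨hs.le, hs1⟩ hAB
  have : (fun x : ℝ => if x = 0 then 0 else x ^ s) = fun x => x ^ s := by
    ext x; split_ifs with hx
    · simp [hx, hs.ne']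
    · rfl
  rw [suppPow, suppPow, this, ← CFC.rpow_eq_cfc_real hA.nonneg, ← CFC.rpow_eq_cfc_real (hA.nonneg.trans hAB)]
  exact h

end Monotone

/-! ### Binary hypothesis testing. -/

section HypothesisTesting

variable {n : Type u} [Fintype n] [DecidableEq n]

lemma trace_mul_nonneg {A B : Matrix n n ℂ} (hA : A.PosSemidef) (hB : B.PosSemidef) :
    0 ≤ (A * B).trace.re := by
  obtain ⟨C, rfl⟩ := CStarAlgebra.nonneg_iff_eq_star_mul_self.mp hA.nonneg
  rw [Matrix.mul_assoc, Matrix.trace_mul_comm]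
  exact (Complex.le_def.1 (hB.mul_mul_conjTranspose_same C).trace_nonneg).1

lemma trace_mul_le_trace_mul {A B C : Matrix n n ℂ} (hAB : A ≤ B) (hC : C.PosSemidef) :
    (A * C).trace.re ≤ (B * C).trace.re := by
  have := trace_mul_nonneg (Matrix.le_iff.1 hAB) hC
  simpa [Matrix.sub_mul] using this

/-- The spectral projection onto the positive part. -/
lemma exists_pos_projection (D : Matrix n n ℂ) (hD : D.IsHermitian) :
    ∃ T : Matrix n n ℂ, T.PosSemidef ∧ T ≤ 1 ∧ (T * D).PosSemidef ∧ D ≤ T * D := by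
  have hc := continuousOn_spectrum D
  have hsa : IsSelfAdjoint D := hD.isSelfAdjoint
  set f : ℝ → ℝ := fun t => if 0 < t then 1 else 0
  have hTD : cfc f D * D = cfc (fun t => f t * t) D := by
    rw [cfc_mul _ _ D (hc _) (hc _), cfc_id' ℝ D hsa]
  refine ⟨cfc f D, ?_, ?_, ?_, ?_⟩
  · rw [← Matrix.nonneg_iff_posSemidef]
    exact cfc_nonneg fun t _ => by simp only [f]; split_ifs <;> norm_num
  · exact cfc_le_one f D fun t _ => by simp only [f]; split_ifs <;> norm_num
  · rw [← Matrix.nonneg_iff_posSemidef, hTD]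
    exact cfc_nonneg fun t _ => by
      simp only [f]; split_ifs with h
      · simpa using h.le
      · simp
  · rw [hTD]
    conv_lhs => rw [← cfc_id' ℝ D hsa]
    refine cfc_mono (fun t _ => ?_) (hc _) (hc _)
    simp only [f]; split_ifs with h <;> linarith

/-- The quantum Chernoff inequality of Audenaert et al. -/
lemma exists_test_le {A B : Matrix n n ℂ} (hA : A.PosSemidef) (hB : B.PosSemidef) {s : ℝ}
    (hs : 0 ≤ s) (hs1 : s < 1) :
    ∃ T : Matrix n n ℂ, T.PosSemidef ∧ T ≤ 1 ∧
      ((1 - T) * A).trace.re + (T * B).trace.re ≤ (suppPow A s * suppPow B (1 - s)).trace.re := by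
  rcases hs.eq_or_lt with rfl | hs
  -- At `s = 0` the support projection of `A` is a test attaining equality.
  · refine ⟨suppPow A 0, suppPow_posSemidef A hA 0, ?_, ?_⟩
    · exact cfc_le_one _ A fun t _ => by split_ifs <;> simp
    · have h := suppPow_mul_suppPow A hA (zero_add (1 : ℝ))
      rw [suppPow_one A hA] at h
      simp [Matrix.sub_mul, h, suppPow_one B hB]
  obtain ⟨T, hT, hT1, hP, hDP⟩ := exists_pos_projection (A - B) (hA.isHermitian.sub hB.isHermitian)
  refine ⟨T, hT, hT1, ?_⟩
  set P := T * (A - B) with hPdef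
  have hs' : 0 < 1 - s := by linarith
  -- `P` is the positive part of `A - B`, so `B + P` dominates both `A` and `B`.
  have hBP : (B + P).PosSemidef := hB.add hP
  have hBle : B ≤ B + P := by simpa [Matrix.le_iff] using hP
  have hAle : A ≤ B + P := by rw [← sub_le_iff_le_add']; exact hDP
  have e1 : suppPow A (1 - s) * suppPow A s = A := by
    rw [suppPow_mul_suppPow A hA (sub_add_cancel 1 s), suppPow_one A hA]
  have e2 : suppPow B (1 - s) * suppPow B s = B := by
    rw [suppPow_mul_suppPow B hB (sub_add_cancel 1 s), suppPow_one B hB]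
  have e3 : suppPow (B + P) (1 - s) * suppPow (B + P) s = B + P := by
    rw [suppPow_mul_suppPow _ hBP (sub_add_cancel 1 s), suppPow_one _ hBP]
  have hs1' : 1 - s ≤ 1 := by linarith
  -- With `C = B + P`, these three bounds chain to `Tr A - Tr A^s B^(1-s) ≤ Tr A^s (C^(1-s) -
  -- B^(1-s)) ≤ Tr C^s (C^(1-s) - B^(1-s)) ≤ Tr C - Tr B = Tr P`.
  have h1 := trace_mul_le_trace_mul (suppPow_mono hA hAle hs' hs1') (suppPow_posSemidef A hA s)
  have h2 := trace_mul_le_trace_mul (suppPow_mono hA hAle hs hs1.le)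
    (Matrix.le_iff.1 (suppPow_mono hB hBle hs' hs1'))
  have h3 := trace_mul_le_trace_mul (suppPow_mono hB hBle hs hs1.le) (suppPow_posSemidef B hB (1 - s))
  rw [Matrix.mul_sub, Matrix.mul_sub, Matrix.trace_sub, Matrix.trace_sub,
    Matrix.trace_mul_comm _ (suppPow (B + P) (1 - s)),
    Matrix.trace_mul_comm (suppPow (B + P) s) (suppPow (B + P) (1 - s)), e3] at h2
  rw [e1] at h1
  rw [Matrix.trace_mul_comm, e2] at h3
  have hPtr : P.trace.re = (T * A).trace.re - (T * B).trace.re := by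
    simp [hPdef, Matrix.mul_sub]
  simp only [Matrix.trace_add, Complex.add_re, Complex.sub_re, Matrix.sub_mul, Matrix.one_mul,
    Matrix.trace_sub] at *
  linarith

end HypothesisTesting

/-! ### The square-root measurement. -/

section HayashiNagaoka

variable {n : Type u} [Fintype n] [DecidableEq n]

open scoped Matrix.Norms.L2Operator in
/-- The Hayashi–Nagaoka operator inequality. -/
lemma hayashi_nagaoka {T S : Matrix n n ℂ} (hT : T.PosSemidef) (hT1 : T ≤ 1) (hS : S.PosSemidef) :
    1 - suppPow (T + S) (-(1 / 2)) * T * suppPow (T + S) (-(1 / 2)) ≤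
      (2 : ℝ) • (1 - T) + (4 : ℝ) • S := by
  have hG : (T + S).PosSemidef := hT.add hS
  set G := T + S with hGdef
  set X := suppPow G (-(1 / 2)) with hX
  set P := suppPow G 0 with hPdef
  set Q := suppPow G (1 / 2) with hQdef
  have hXG : X * G = Q := by
    conv_lhs => rw [← suppPow_one G hG]
    exact suppPow_mul_suppPow G hG (by norm_num)
  have hGX : G * X = Q := by
    conv_lhs => rw [← suppPow_one G hG]
    exact suppPow_mul_suppPow G hG (by norm_num)
  have hQX : Q * X = P := suppPow_mul_suppPow G hG (by norm_num)
  have hP1 : P ≤ 1 := cfc_le_one _ G fun t _ => by split_ifs <;> simp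
  -- `T ≤ T^(1/2)` because the spectrum of `T` lies in `[0,1]`, and `T^(1/2) ≤ G^(1/2)` by
  -- monotonicity.
  have hTQ : T ≤ Q := by
    refine le_trans ?_ (suppPow_mono hT (by simpa [Matrix.le_iff, hGdef] using hS)
      (by norm_num : (0 : ℝ) < 1 / 2) (by norm_num))
    conv_lhs => rw [← suppPow_one T hT]
    refine cfc_mono (fun t ht => ?_) (continuousOn_spectrum _ _) (continuousOn_spectrum _ _)
    have h0 := spectrum_nonneg_of_nonneg hT.nonneg ht
    have h1 : t ≤ 1 := (cfc_le_one_iff (fun t : ℝ => t) T (continuousOn_spectrum _ _)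
      hT.isHermitian.isSelfAdjoint).1 (by rwa [cfc_id' ℝ T hT.isHermitian.isSelfAdjoint]) t ht
    split_ifs with hz
    · rfl
    · exact Real.rpow_le_rpow_of_exponent_ge (lt_of_le_of_ne h0 (Ne.symm hz)) h1 (by norm_num)
  have hXh : Xᴴ = X := (suppPow_posSemidef G hG _).isHermitian
  have a1 : ((X - 2) * S * (X - 2)).PosSemidef := by
    have := hS.mul_mul_conjTranspose_same (X - 2)
    rwa [Matrix.conjTranspose_sub, hXh, show (2 : Matrix n n ℂ)ᴴ = 2 from Matrix.conjTranspose_ofNat 2] at this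
  have a2 : ((X - 1) * T * (X - 1)).PosSemidef := by
    have := hT.mul_mul_conjTranspose_same (X - 1)
    rwa [Matrix.conjTranspose_sub, hXh, Matrix.conjTranspose_one] at this
  have hXGX : X * G * X = P := by rw [hXG, hQX]
  -- Completing squares: every summand on the right is positive, and the cross terms combine through
  -- `X G = G X = Q` to `-4 Q`, which cancels.
  have key : ((2 : ℝ) • (1 - T) + (4 : ℝ) • S) - (1 - X * T * X) =
      (X - 2) * S * (X - 2) + (2 : ℝ) • ((X - 1) * T * (X - 1)) + (4 : ℝ) • (Q - T) + (1 - P) := by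
    have t1 : X * T * X = P - X * S * X := by
      rw [← hXGX, hGdef]; noncomm_ring
    have t2 : X * T = Q - X * S := by rw [← hXG, hGdef]; noncomm_ring
    have t3 : T * X = Q - S * X := by rw [← hGX, hGdef]; noncomm_ring
    have t4 : (X - 1) * T * (X - 1) = X * T * X - X * T - T * X + T := by noncomm_ring
    have t5 : (X - 2) * S * (X - 2) = X * S * X - 2 * (X * S) - 2 * (S * X) + 4 * S := by
      noncomm_ring
    rw [t4, t1, t2, t3, t5]
    have r2 : ∀ Y : Matrix n n ℂ, (2 : ℝ) • Y = 2 * Y := fun Y => by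
      rw [two_mul, two_smul]
    have r4 : ∀ Y : Matrix n n ℂ, (4 : ℝ) • Y = 4 * Y := fun Y => by
      rw [show (4 : ℝ) = 2 + 2 by norm_num, add_smul, r2]; noncomm_ring
    simp only [r2, r4]
    noncomm_ring
  rw [Matrix.le_iff, key]
  exact ((a1.add (a2.smul (by norm_num))).add ((Matrix.le_iff.1 hTQ).smul (by norm_num))).add
    (Matrix.le_iff.1 hP1)

end HayashiNagaoka

/-- The square-root (pretty good) measurement, completed to a POVM, together with the
Hayashi–Nagaoka bound on its error operators. -/
lemma exists_povm_of_tests {n : Type u} [Fintype n] [DecidableEq n] {ι : Type*} [Fintype ι]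
    [DecidableEq ι] (i₀ : ι) (T : ι → Matrix n n ℂ) (hT : ∀ i, (T i).PosSemidef)
    (hT1 : ∀ i, T i ≤ 1) :
    ∃ Λ : ι → Matrix n n ℂ, (∀ i, (Λ i).PosSemidef) ∧ ∑ i, Λ i = 1 ∧
      ∀ i, 1 - Λ i ≤ (2 : ℝ) • (1 - T i) + (4 : ℝ) • ∑ j ∈ Finset.univ.erase i, T j := by
  set G := ∑ i, T i with hGdef
  have hG : G.PosSemidef := Matrix.posSemidef_sum _ fun i _ => hT i
  set X := suppPow G (-(1 / 2)) with hX
  have hXh : Xᴴ = X := (suppPow_posSemidef G hG _).isHermitian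
  have hP1 : (1 - suppPow G 0).PosSemidef :=
    Matrix.le_iff.1 (cfc_le_one _ G fun t _ => by split_ifs <;> simp)
  have hXGX : X * G * X = suppPow G 0 := by
    conv_lhs => rw [← suppPow_one G hG]
    rw [suppPow_mul_suppPow G hG (rfl : (-(1 / 2) + 1 : ℝ) = _),
      suppPow_mul_suppPow G hG (by norm_num : (-(1 / 2) + 1 + -(1 / 2) : ℝ) = 0)]
  have hrest : ∀ i, (if i = i₀ then 1 - suppPow G 0 else 0 : Matrix n n ℂ).PosSemidef := by
    intro i
    split_ifs
    exacts [hP1, Matrix.PosSemidef.zero]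
  have hXTX : ∀ i, (X * T i * X).PosSemidef := fun i => by
    simpa [hXh] using (hT i).mul_mul_conjTranspose_same X
  -- The sandwiched tests sum only to the support projection of `G`; outcome `i₀` receives the rest,
  -- which can only shrink its error operator.
  refine ⟨fun i => X * T i * X + if i = i₀ then 1 - suppPow G 0 else 0,
    fun i => (hXTX i).add (hrest i), ?_, fun i => ?_⟩
  · rw [Finset.sum_add_distrib, ← Finset.sum_mul, ← Finset.mul_sum, ← hGdef, hXGX]
    simp
  · have h := hayashi_nagaoka (hT i) (hT1 i)
      (Matrix.posSemidef_sum (Finset.univ.erase i) fun j _ => hT j)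
    rw [Finset.add_sum_erase _ _ (Finset.mem_univ i), ← hGdef, ← hX] at h
    exact (sub_le_sub_left (le_add_of_nonneg_right (hrest i).nonneg) 1).trans h

/-! ### Marginals and channels acting on one half. -/

section Channel

lemma marginalRight_posSemidef {R B : Type u} [Fintype R] {X : Matrix (R × B) (R × B) ℂ} (hX : X.PosSemidef) :
    (marginalRight X).PosSemidef := by
  have : marginalRight X = ∑ r, X.submatrix (fun a => (r, a)) (fun a => (r, a)) := by
    ext a a'
    simp [marginalRight, Matrix.sum_apply]
  rw [this]
  exact Matrix.posSemidef_sum _ fun r _ => hX.submatrix _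

variable {R A B : Type u} [Fintype A]

lemma Channel.onRight_posSemidef [Fintype R] [Fintype B] (N : Channel A B) {X : Matrix (R × A) (R × A) ℂ}
    (hX : X.PosSemidef) : (N.onRight X).PosSemidef := by
  let e := Fintype.equivFin R
  have h := N.completelyPositive _ _ (hX.submatrix fun x : Fin (Fintype.card R) × A => (e.symm x.1, x.2))
  convert h.submatrix (fun x : R × B => (e x.1, x.2)) using 1
  ext x y
  simp [Channel.onRight, idTensor]

lemma Channel.marginalLeft_onRight [Fintype B] (N : Channel A B) (X : Matrix (R × A) (R × A) ℂ) :
    marginalLeft (N.onRight X) = marginalLeft X := by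
  ext r r'
  exact N.tracePreserving (Matrix.of fun a a' => X (r, a) (r', a'))

lemma trace_marginalLeft [Fintype R] (X : Matrix (R × A) (R × A) ℂ) : (marginalLeft X).trace = X.trace := by
  simp [Matrix.trace, marginalLeft, Fintype.sum_prod_type]

lemma Channel.trace_onRight [Fintype R] [Fintype B] (N : Channel A B) (X : Matrix (R × A) (R × A) ℂ) :
    (N.onRight X).trace = X.trace := by
  rw [← trace_marginalLeft, N.marginalLeft_onRight, trace_marginalLeft]

lemma marginalLeft_posSemidef {X : Matrix (R × A) (R × A) ℂ} (hX : X.PosSemidef) :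
    (marginalLeft X).PosSemidef := by
  have : marginalLeft X = ∑ a, X.submatrix (fun r => (r, a)) (fun r => (r, a)) := by
    ext r r'
    simp [marginalLeft, Matrix.sum_apply]
  rw [this]
  exact Matrix.posSemidef_sum _ fun a _ => hX.submatrix _

lemma IsPureState.isState {ρ : Matrix A A ℂ} (h : IsPureState ρ) : IsState ρ := by
  obtain ⟨ψ, hψ, rfl⟩ := h
  refine ⟨Matrix.posSemidef_vecMulVec_self_star ψ, ?_⟩
  have : ∀ i, ψ i * star (ψ i) = ((‖ψ i‖ ^ 2 : ℝ) : ℂ) := fun i => by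
    simpa using Complex.mul_conj' (ψ i)
  simp only [Matrix.trace, Matrix.diag_apply, Matrix.vecMulVec_apply, Pi.star_apply, this]
  rw [← Complex.ofReal_sum, hψ, Complex.ofReal_one]

end Channel

/-! ### Tensor powers and operators placed at one position. -/

section PositionBasedCoding

variable {ι : Type} [Fintype ι] [DecidableEq ι] {R A B : Type u}

/-- The tensor power of a bipartite operator, as an operator of `R^ι × A^ι`. -/
def tensorPower (θ : Matrix (R × A) (R × A) ℂ) :
    Matrix ((ι → R) × (ι → A)) ((ι → R) × (ι → A)) ℂ :=
  Matrix.of fun x y => ∏ i, θ (x.1 i, x.2 i) (y.1 i, y.2 i)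

lemma IsPureState.isState_tensorPower [Fintype R] [Fintype A] {θ : Matrix (R × A) (R × A) ℂ}
    (h : IsPureState θ) : IsState (tensorPower (ι := ι) θ) := by
  obtain ⟨ψ, -, hθ⟩ := id h
  refine ⟨?_, ?_⟩
  · have : tensorPower (ι := ι) θ = Matrix.vecMulVec (fun x => ∏ i, ψ (x.1 i, x.2 i))
        (star fun x => ∏ i, ψ (x.1 i, x.2 i)) := by
      ext x y
      simp [tensorPower, hθ, Matrix.vecMulVec_apply, Finset.prod_mul_distrib]
    rw [this]
    exact Matrix.posSemidef_vecMulVec_self_star _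
  · have h1 : (tensorPower (ι := ι) θ).trace = ∑ z : ι → R × A, ∏ i, θ (z i) (z i) :=
      Fintype.sum_equiv (Equiv.arrowProdEquivProdArrow ι (fun _ => R) (fun _ => A)).symm _ _
        fun x => rfl
    rw [h1]
    refine (Fintype.prod_sum fun _ z => θ z z).symm.trans ?_
    exact Finset.prod_eq_one fun i _ => h.isState.2

/-- The channel that discards all systems of `A^ι` but the one at position `m`. -/
def discardExcept [Fintype A] (m : ι) : Channel (ι → A) A where
  toMap :=
    { toFun := fun X => Matrix.of fun a a' => ∑ y : {i // i ≠ m} → A,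
        X ((Equiv.funSplitAt m A).symm (a, y)) ((Equiv.funSplitAt m A).symm (a', y))
      map_add' := fun X Y => by ext; simp [Finset.sum_add_distrib]
      map_smul' := fun c X => by ext; simp [Finset.mul_sum] }
  completelyPositive := fun k X hX => by
    let f (y : {i // i ≠ m} → A) (x : Fin k × A) : Fin k × (ι → A) :=
      (x.1, (Equiv.funSplitAt m A).symm (x.2, y))
    -- A partial trace is a sum of principal submatrices, one per basis vector of the discarded
    -- systems.
    have : ∀ Y : Matrix (Fin k × A) (Fin k × A) ℂ,
        Y = ∑ y, X.submatrix (f y) (f y) → Y.PosSemidef := by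
      rintro _ rfl
      exact Matrix.posSemidef_sum _ fun y _ => hX.submatrix _
    refine this _ ?_
    ext x x'
    simp [idTensor, Matrix.sum_apply, f]
  tracePreserving := fun X => by
    simp only [Matrix.trace, Matrix.diag_apply, LinearMap.coe_mk, AddHom.coe_mk, Matrix.of_apply]
    rw [← Fintype.sum_prod_type' (f := fun a y => X ((Equiv.funSplitAt m A).symm (a, y))
      ((Equiv.funSplitAt m A).symm (a, y)))]
    exact Fintype.sum_equiv (Equiv.funSplitAt m A).symm _ _ fun x => rfl

/-- The operator of `R^ι × B` with factor `ρ` at position `m` (and `B`) and factors `τ` at the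
other positions. -/
def placeAt (m : ι) (ρ : Matrix (R × B) (R × B) ℂ) (τ : Matrix R R ℂ) :
    Matrix ((ι → R) × B) ((ι → R) × B) ℂ :=
  Matrix.of fun x y =>
    ∏ i, if i = m then ρ (x.1 i, x.2) (y.1 i, y.2) else τ (x.1 i) (y.1 i)

lemma placeAt_apply (m : ι) (ρ : Matrix (R × B) (R × B) ℂ) (τ : Matrix R R ℂ)
    (x y : (ι → R) × B) : placeAt m ρ τ x y =
      ρ (x.1 m, x.2) (y.1 m, y.2) * ∏ i : {i // i ≠ m}, τ (x.1 i) (y.1 i) := by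
  rw [placeAt, Matrix.of_apply, Fintype.prod_eq_mul_prod_subtype_ne _ m, if_pos rfl]
  congr 1
  exact Finset.prod_congr rfl fun i _ => if_neg i.2

lemma onRight_discardExcept_tensorPower [Fintype A] (m : ι) (θ : Matrix (R × A) (R × A) ℂ) :
    (discardExcept m).onRight (tensorPower θ) = placeAt m θ (marginalLeft θ) := by
  ext x x'
  rw [placeAt_apply]
  simp only [Channel.onRight, idTensor, discardExcept, tensorPower, LinearMap.coe_mk,
    AddHom.coe_mk, Matrix.of_apply, marginalLeft, Fintype.prod_sum, Finset.mul_sum]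
  refine Finset.sum_congr rfl fun y _ => ?_
  rw [Fintype.prod_eq_mul_prod_subtype_ne _ m]
  congr 1
  · simp
  · exact Finset.prod_congr rfl fun i _ => by simp [i.2]

lemma Channel.onRight_placeAt [Fintype A] [Fintype B] (N : Channel A B) (m : ι)
    (θ : Matrix (R × A) (R × A) ℂ) (τ : Matrix R R ℂ) :
    N.onRight (placeAt m θ τ) = placeAt m (N.onRight θ) τ := by
  ext x x'
  rw [placeAt_apply]
  simp only [Channel.onRight, idTensor, Matrix.of_apply]
  have : (Matrix.of fun a a' => placeAt m θ τ (x.1, a) (x'.1, a')) =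
      (∏ i : {i // i ≠ m}, τ (x.1 i) (x'.1 i)) •
        (Matrix.of fun a a' => θ (x.1 m, a) (x'.1 m, a')) := by
    ext a a'
    simp [placeAt_apply, mul_comm]
  rw [this, map_smul, Matrix.smul_apply, smul_eq_mul, mul_comm]

variable [DecidableEq R]

lemma placeAt_one_eq_submatrix (m : ι) (T : Matrix (R × B) (R × B) ℂ) :
    placeAt m T 1 = (T ⊗ₖ (1 : Matrix ({i // i ≠ m} → R) ({i // i ≠ m} → R) ℂ)).submatrix
      (fun x => ((x.1 m, x.2), fun i => x.1 i)) (fun x => ((x.1 m, x.2), fun i => x.1 i)) := by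
  ext x y
  rw [placeAt_apply]
  simp [Matrix.one_apply, Finset.prod_boole, funext_iff]

variable [Fintype R] [Fintype B]

lemma placeAt_one_posSemidef [DecidableEq B] (m : ι) {T : Matrix (R × B) (R × B) ℂ}
    (hT : T.PosSemidef) : (placeAt m T 1).PosSemidef := by
  rw [placeAt_one_eq_submatrix]
  exact (hT.kronecker Matrix.PosSemidef.one).submatrix _

lemma placeAt_one_le_one [DecidableEq B] (m : ι) {T : Matrix (R × B) (R × B) ℂ}
    (hT : T ≤ 1) : placeAt m T 1 ≤ 1 := by
  have h := placeAt_one_posSemidef m (Matrix.le_iff.1 hT)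
  have h1 : placeAt m (1 : Matrix (R × B) (R × B) ℂ) 1 = 1 := by
    rw [placeAt_one_eq_submatrix, Matrix.one_kronecker_one]
    refine Matrix.submatrix_one _ fun x y hxy => ?_
    simp only [Prod.mk.injEq, funext_iff] at hxy
    refine Prod.ext (funext fun i => ?_) hxy.1.2
    by_cases hi : i = m
    · exact hi ▸ hxy.1.1
    · exact hxy.2 ⟨i, hi⟩
  have h2 : placeAt m (1 - T) (1 : Matrix R R ℂ) = placeAt m 1 1 - placeAt m T 1 := by
    ext x y
    simp only [Matrix.sub_apply, placeAt_apply, sub_mul]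
  rw [Matrix.le_iff, ← h1, ← h2]
  exact h

/-- Only `B` links the positions, so once its two indices are fixed the trace factorizes. -/
lemma trace_placeAt_mul_placeAt (j m : ι) (T ρ : Matrix (R × B) (R × B) ℂ) (τ : Matrix R R ℂ) :
    (placeAt j T 1 * placeAt m ρ τ).trace = ∑ b, ∑ b', ∏ i, ∑ p, ∑ p',
      (if i = j then T (p, b) (p', b') else (1 : Matrix R R ℂ) p p') *
        (if i = m then ρ (p', b') (p, b) else τ p' p) := by
  simp only [Matrix.trace, Matrix.diag_apply, Matrix.mul_apply, Fintype.sum_prod_type_right,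
    Fintype.prod_sum, placeAt, Matrix.of_apply, ← Finset.prod_mul_distrib]
  refine Finset.sum_congr rfl fun b _ => ?_
  rw [Finset.sum_comm]

lemma trace_placeAt_mul_placeAt_same (m : ι) (T ρ : Matrix (R × B) (R × B) ℂ) (τ : Matrix R R ℂ)
    (hτ : τ.trace = 1) : (placeAt m T 1 * placeAt m ρ τ).trace = (T * ρ).trace := by
  rw [trace_placeAt_mul_placeAt]
  have h : ∀ b b', (∏ i, ∑ p, ∑ p',
      (if i = m then T (p, b) (p', b') else (1 : Matrix R R ℂ) p p') *
        (if i = m then ρ (p', b') (p, b) else τ p' p)) =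
      ∑ p, ∑ p', T (p, b) (p', b') * ρ (p', b') (p, b) := fun b b' => by
    rw [Fintype.prod_eq_single m]
    · simp
    · intro i hi
      simpa [hi, Matrix.one_apply, Matrix.trace] using hτ
  simp only [h, Matrix.trace, Matrix.diag_apply, Matrix.mul_apply, Fintype.sum_prod_type_right]
  refine Finset.sum_congr rfl fun b _ => ?_
  rw [Finset.sum_comm]

/-- A test at a wrong position sees a product state: position `m` is traced out of `ρ`, leaving its
marginal on `B`, and `τ` sits at position `j`. -/
lemma trace_placeAt_mul_placeAt_ne {j m : ι} (hjm : j ≠ m) (T ρ : Matrix (R × B) (R × B) ℂ)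
    (τ : Matrix R R ℂ) (hτ : τ.trace = 1) :
    (placeAt j T 1 * placeAt m ρ τ).trace = (T * (τ ⊗ₖ marginalRight ρ)).trace := by
  rw [trace_placeAt_mul_placeAt]
  have h : ∀ b b', (∏ i, ∑ p, ∑ p',
      (if i = j then T (p, b) (p', b') else (1 : Matrix R R ℂ) p p') *
        (if i = m then ρ (p', b') (p, b) else τ p' p)) =
      ∑ p, ∑ p', T (p, b) (p', b') * (τ p' p * marginalRight ρ b' b) := fun b b' => by
    rw [Fintype.prod_eq_mul j m hjm]
    · simp [hjm, hjm.symm, Matrix.one_apply, marginalRight, Finset.sum_mul, mul_assoc]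
    · intro i hi
      simpa [hi.1, hi.2, Matrix.one_apply, Matrix.trace] using hτ
  simp only [h, Matrix.trace, Matrix.diag_apply, Matrix.mul_apply, Fintype.sum_prod_type_right,
    Matrix.kroneckerMap_apply]
  refine Finset.sum_congr rfl fun b _ => ?_
  rw [Finset.sum_comm]

end PositionBasedCoding

/-! ### Error of the code and passage to logarithms. -/

variable {R A B : Type u} [Fintype R] [DecidableEq R] [Fintype A] [Fintype B] [DecidableEq B]

/-- Position-based coding: the error of a code built from a pure state `θ`. -/
lemma exists_code_avgError_le (N : Channel A B) {M : ℕ} (hM : 0 < M)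
    {θ : Matrix (R × A) (R × A) ℂ} (hθ : IsPureState θ) {s : ℝ} (hs : 0 ≤ s) (hs1 : s < 1) :
    ∃ C : EACode N M (Fin M → R) (Fin M → A), 0 ≤ C.avgError ∧ C.avgError ≤ 1 ∧
      C.avgError ≤ 4 * ((M : ℝ) ^ (1 - s) * (suppPow (N.onRight θ) s *
        suppPow (marginalLeft (N.onRight θ) ⊗ₖ marginalRight (N.onRight θ)) (1 - s)).trace.re) := by
  have hM' : (0 : ℝ) < M := by exact_mod_cast hM
  have hρ : (N.onRight θ).PosSemidef := N.onRight_posSemidef hθ.isState.1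
  have hρ1 : (N.onRight θ).trace = 1 := (N.trace_onRight θ).trans hθ.isState.2
  set ρ := N.onRight θ with hρdef
  set τ := marginalLeft ρ with hτdef
  have hτ : τ.trace = 1 := (trace_marginalLeft ρ).trans hρ1
  set σ := τ ⊗ₖ marginalRight ρ with hσdef
  have hσ : σ.PosSemidef := (marginalLeft_posSemidef hρ).kronecker (marginalRight_posSemidef hρ)
  -- The weight `M` on `σ` pays for the `M - 1` wrong positions and yields the factor `M^(1-s)`.
  obtain ⟨T, hT, hT1, hTle⟩ := exists_test_le hρ (hσ.smul hM'.le) hs hs1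
  obtain ⟨Λ, hΛ, hΛ1, hΛle⟩ := exists_povm_of_tests (⟨0, hM⟩ : Fin M)
    (fun j => placeAt j T (1 : Matrix R R ℂ)) (fun j => placeAt_one_posSemidef j hT)
    (fun j => placeAt_one_le_one j hT1)
  have hshared := hθ.isState_tensorPower (ι := Fin M)
  have hω : ∀ m : Fin M, N.onRight ((discardExcept m).onRight (tensorPower θ)) = placeAt m ρ τ :=
    fun m => by rw [onRight_discardExcept_tensorPower, N.onRight_placeAt, hτdef, hρdef,
      N.marginalLeft_onRight]
  have hωpos : ∀ m : Fin M, (placeAt m ρ τ).PosSemidef := fun m =>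
    hω m ▸ N.onRight_posSemidef ((discardExcept m).onRight_posSemidef hshared.1)
  have hω1 : ∀ m : Fin M, (placeAt m ρ τ).trace = 1 := fun m => by
    rw [← hω, N.trace_onRight, Channel.trace_onRight, hshared.2]
  have hΛle1 : ∀ m, Λ m ≤ 1 := fun m => hΛ1 ▸
    Finset.single_le_sum (f := Λ) (fun j _ => (hΛ j).nonneg) (Finset.mem_univ m)
  have hbound : ∀ m, ((1 - Λ m) * placeAt m ρ τ).trace.re ≤
      4 * ((M : ℝ) ^ (1 - s) * (suppPow ρ s * suppPow σ (1 - s)).trace.re) := fun m => by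
    have h := trace_mul_le_trace_mul (hΛle m) (hωpos m)
    have hsum : (∑ j ∈ Finset.univ.erase m,
        (placeAt j T (1 : Matrix R R ℂ) * placeAt m ρ τ).trace) =
        ((M : ℂ) - 1) * (T * σ).trace := by
      rw [Finset.sum_congr rfl fun j hj =>
        trace_placeAt_mul_placeAt_ne (Finset.ne_of_mem_erase hj) T ρ τ hτ]
      simp [Finset.card_erase_of_mem, Nat.cast_sub (Nat.one_le_iff_ne_zero.2 hM.ne'), hσdef]
    have e : (((2 : ℝ) • (1 - placeAt m T (1 : Matrix R R ℂ)) +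
        (4 : ℝ) • ∑ j ∈ Finset.univ.erase m, placeAt j T (1 : Matrix R R ℂ)) *
        placeAt m ρ τ).trace.re =
        2 * (1 - (T * ρ).trace.re) + 4 * (((M : ℝ) - 1) * (T * σ).trace.re) := by
      rw [Matrix.add_mul, Matrix.smul_mul, Matrix.smul_mul, Matrix.sub_mul, Matrix.one_mul,
        Matrix.sum_mul, Matrix.trace_add, Matrix.trace_smul, Matrix.trace_smul, Matrix.trace_sub,
        Matrix.trace_sum, hsum, hω1, trace_placeAt_mul_placeAt_same m T ρ τ hτ]
      simp
    rw [e] at h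
    have hTρ := trace_mul_nonneg (Matrix.le_iff.1 hT1) hρ
    have hTσ := trace_mul_nonneg hT hσ
    rw [suppPow_smul σ hσ hM'] at hTle
    simp only [Matrix.sub_mul, Matrix.one_mul, Matrix.trace_sub, Matrix.mul_smul,
      Matrix.trace_smul, hρ1, Complex.sub_re, Complex.one_re, Complex.real_smul,
      Complex.re_ofReal_mul] at hTle hTρ h ⊢
    linarith
  refine ⟨⟨tensorPower θ, hshared, discardExcept, Λ, hΛ, hΛ1⟩, ?_, ?_, ?_⟩
  all_goals simp only [EACode.avgError, hω, one_div]
  · exact mul_nonneg (by positivity) (Finset.sum_nonneg fun m _ =>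
      trace_mul_nonneg (Matrix.le_iff.1 (hΛle1 m)) (hωpos m))
  · rw [inv_mul_le_iff₀ hM', mul_one]
    refine (Finset.sum_le_card_nsmul _ _ 1 fun m _ => ?_).trans (by simp)
    have := trace_mul_nonneg (hΛ m) (hωpos m)
    simpa [Matrix.sub_mul, hω1] using this
  · rw [inv_mul_le_iff₀ hM']
    exact (Finset.sum_le_card_nsmul _ _ _ fun m _ => hbound m).trans (by simp)

lemma optError_le_one (N : Channel A B) (M : ℕ) : optError N M ≤ 1 := by
  rcases Set.eq_empty_or_nonempty {ε : ℝ | ε ∈ Set.Icc (0 : ℝ) 1 ∧ HasEACode N M ε} with h | ⟨ε, h⟩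
  · rw [optError, h, Real.sInf_empty]
    exact zero_le_one
  · exact (csInf_le ⟨0, fun x hx => hx.1.1⟩ h).trans h.1.2

lemma optError_le (N : Channel A B) {M : ℕ} (hM : 0 < M)
    {θ : Matrix (R × A) (R × A) ℂ} (hθ : IsPureState θ) {s : ℝ} (hs : 0 ≤ s) (hs1 : s < 1) :
    optError N M ≤ 4 * ((M : ℝ) ^ (1 - s) * (suppPow (N.onRight θ) s *
      suppPow (marginalLeft (N.onRight θ) ⊗ₖ marginalRight (N.onRight θ)) (1 - s)).trace.re) := by
  obtain ⟨C, h0, h1, h⟩ := exists_code_avgError_le N hM hθ hs hs1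
  have hC : C.avgError ∈ {ε : ℝ | ε ∈ Set.Icc (0 : ℝ) 1 ∧ HasEACode N M ε} :=
    ⟨⟨h0, h1⟩, _, _, inferInstance, inferInstance, inferInstance, C, le_rfl⟩
  exact (csInf_le ⟨0, fun x hx => hx.1.1⟩ hC).trans h

lemma renyiMutualInfo_le (N : Channel A B) {M : ℕ} (hM : 0 < M) (hε : 0 < optError N M)
    {θ : Matrix (R × A) (R × A) ℂ} (hθ : IsPureState θ) {s : ℝ} (hs : 0 ≤ s) (hs1 : s < 1) :
    renyiMutualInfo s (N.onRight θ) ≤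
      (((-Real.logb 2 (optError N M) + 2) / (1 - s) + Real.logb 2 M : ℝ) : EReal) := by
  have hM' : (0 : ℝ) < M := by exact_mod_cast hM
  have h := optError_le N hM hθ hs hs1
  rw [renyiMutualInfo, renyiDiv, if_neg hs1.ne, if_neg (fun hc => hc.1.not_ge hs1.le)]
  set Q := (suppPow (N.onRight θ) s *
    suppPow (marginalLeft (N.onRight θ) ⊗ₖ marginalRight (N.onRight θ)) (1 - s)).trace.re
  have hMs : 0 < (M : ℝ) ^ (1 - s) := Real.rpow_pos_of_pos hM' _
  have hQ : 0 < Q := by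
    -- If `Q ≤ 0`, the bound `h` would contradict `0 < optError N M`.
    by_contra hQ
    nlinarith
  rw [log2, if_pos hQ, ← EReal.coe_mul, EReal.coe_le_coe_iff]
  have hlog := Real.logb_le_logb_of_le one_lt_two hε h
  rw [Real.logb_mul four_ne_zero (by positivity), Real.logb_mul hMs.ne' hQ.ne',
    Real.logb_rpow_eq_mul_logb_of_pos hM', show (4 : ℝ) = 2 ^ (2 : ℝ) by norm_num,
    Real.logb_rpow two_pos one_lt_two.ne'] at hlog
  have hs' : 0 < 1 - s := sub_pos.2 hs1
  have e : 1 / (s - 1) * Real.logb 2 Q = -Real.logb 2 Q / (1 - s) := by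
    rw [← neg_sub 1 s]; field_simp
  rw [e, div_add' _ _ _ hs'.ne', div_le_div_iff_of_pos_right hs']
  linarith

end QInfo

theorem mainTheorem2 {A B : Type u} [Fintype A] [Nonempty A] [Fintype B] [DecidableEq B]
    (N : QInfo.Channel A B) (M : ℕ) (hM : 0 < M) :
    (⨆ s ∈ Set.Icc (0 : ℝ) 1,
        ((1 - s : ℝ) : EReal) *
          (QInfo.supRenyiMutualInfo N s - ((Real.logb 2 (M : ℝ) : ℝ) : EReal))) - 2
      ≤ - QInfo.log2 (QInfo.optError N M) := by
  rw [QInfo.log2]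
  split_ifs with hε
  swap
  -- Zero optimal error makes the right-hand side `⊤`.
  · simp
  set x := Real.logb 2 (QInfo.optError N M)
  have hx0 : x ≤ 0 := Real.logb_nonpos one_lt_two hε.le (QInfo.optError_le_one N M)
  suffices h : (⨆ s ∈ Set.Icc (0 : ℝ) 1, ((1 - s : ℝ) : EReal) *
      (QInfo.supRenyiMutualInfo N s - ((Real.logb 2 (M : ℝ) : ℝ) : EReal))) ≤
      ((-x + 2 : ℝ) : EReal) by
    refine (EReal.sub_le_sub h le_rfl).trans (le_of_eq ?_)
    rw [show (2 : EReal) = ((2 : ℝ) : EReal) from rfl, ← EReal.coe_sub, ← EReal.coe_neg]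
    simp
  refine iSup₂_le fun s hs => ?_
  rcases hs.2.eq_or_lt with rfl | hs1
  -- At `s = 1` the term is `0` whatever the mutual information, as `0 * ⊤ = 0` in `EReal`; the
  -- bound then only needs `x ≤ 0`.
  · rw [sub_self, EReal.coe_zero, zero_mul, ← EReal.coe_zero, EReal.coe_le_coe_iff]
    linarith
  have hs' : 0 < 1 - s := sub_pos.2 hs1
  have hsup : QInfo.supRenyiMutualInfo N s ≤
      (((-x + 2) / (1 - s) + Real.logb 2 M : ℝ) : EReal) :=
    iSup_le fun R => iSup_le fun _ => iSup_le fun _ => iSup_le fun θ => iSup_le fun hθ =>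
      QInfo.renyiMutualInfo_le N hM hε hθ hs.1 hs1
  refine (mul_le_mul_of_nonneg_left (EReal.sub_le_sub hsup le_rfl)
    (EReal.coe_nonneg.2 hs'.le)).trans (le_of_eq ?_)
  rw [← EReal.coe_sub, ← EReal.coe_mul, EReal.coe_eq_coe_iff]
  field_simp
  ring
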